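/- Let $K$ be an infinite scattered compact Hausdorff space (scattered: every nonempty subspace has an isolated point). Let $C(K)$ be the Banach space of continuous real-valued functions on $K$ with the supremum norm, and equip its dual $C(K)^*$, and the closed unit ball $B_{C(K)^*}$ of the dual norm, with the weak$^*$ topology. For a topological space $X$ let $d(X)$ be the least cardinality of a dense subset of $X$, and let $hd(X)=\sup\{d(Y): Y\subseteq X\}$ be its hereditary density, where each $Y\subseteq X$ carries the subspace topology; $X$ is hereditarily separable if each of its subspaces has a countable dense subset. All powers carry the product topology. Then $$hd(K^\omega)=hd\big((B_{C(K)^*})^\omega\big).$$ Moreover, the following three conditions are equivalent: (a) $K^n$ is hereditarily separable for every $n\in\mathbb{N}$; (b) $(C(K)^*)^n$ is hereditarily separable for every $n\in\mathbb{N}$; (c) $(B_{C(K)^*})^n$ is hereditarily separable for every $n\in\mathbb{N}$. -/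

import Mathlib

open Cardinal

universe u

/-- The density of a topological space: the least cardinality of a dense subset. -/
noncomputable def topDensity (X : Type u) [TopologicalSpace X] : Cardinal.{u} :=
  sInf {κ : Cardinal.{u} | ∃ D : Set X, Dense D ∧ #D = κ}

/-- The hereditary density of a topological space: the supremum of the densities of its
subspaces. (The supremum is over a family indexed by a `u`-small type, hence bounded.) -/
noncomputable def hereditaryDensity (X : Type u) [TopologicalSpace X] : Cardinal.{u} :=
  ⨆ Y : Set X, topDensity Y

/-- A space is hereditarily separable if each of its subspaces has a countable dense subset. -/
def HereditarilySeparable (X : Type u) [TopologicalSpace X] : Prop :=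
  ∀ Y : Set X, TopologicalSpace.SeparableSpace Y

/-- A space is scattered if every nonempty subspace has a (relatively) isolated point. -/
def IsScatteredSpace (X : Type u) [TopologicalSpace X] : Prop :=
  ∀ Y : Set X, Y.Nonempty → ∃ x ∈ Y, ∃ U : Set X, IsOpen U ∧ U ∩ Y = {x}

/-- The closed unit ball (for the dual norm) of the dual of `C(K, ℝ)` with the supremum norm,
as a subset of the dual with its weak* topology. -/
def weakStarDualBall (K : Type u) [TopologicalSpace K] [CompactSpace K] :
    Set (WeakDual ℝ C(K, ℝ)) :=
  {φ | ‖WeakDual.toStrongDual φ‖ ≤ 1}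

/-! On a scattered compact `K` every functional is a norm limit of finite combinations of Dirac
functionals (`IsScatteredSpace.diracClosure_eq_top`). Hence a finite tuple of functionals is coded,
up to norm error `1 / (k + 1)`, by finitely many points of `K` and as many reals. A weak*
neighbourhood tests finitely many functions, so a small norm error is harmless, and the reals are
second countable, so they cost nothing: finite powers of the dual inherit the bound from finite
powers of `K` (`HereditaryDensityLE.pi_weakDual`). The coding is a relation rather than a continuous
map, which is why the transfer principle is `HereditaryDensityLE.of_relations`.

Conversely, the Dirac map embeds `K` in the dual ball. Countable powers reduce to finite ones
because basic open sets restrict finitely many coordinates. Infiniteness of `K` makes the cardinals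
at least `ℵ₀`, so countable unions are free. -/

open TopologicalSpace in
/-- Restriction of a functional on `C(K, ℝ)` to a clopen set. -/
noncomputable def clopenCut {K : Type u} [TopologicalSpace K] [CompactSpace K] (A : Clopens K) :
    StrongDual ℝ C(K, ℝ) →L[ℝ] StrongDual ℝ C(K, ℝ) :=
  ContinuousLinearMap.precomp ℝ
    (ContinuousLinearMap.mul ℝ C(K, ℝ) (LocallyConstant.charFn ℝ A.isClopen : C(K, ℝ)))

/-- The Dirac functional at a point. -/
noncomputable def diracFunctional {K : Type u} [TopologicalSpace K] [CompactSpace K] (x : K) :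
    StrongDual ℝ C(K, ℝ) :=
  ContinuousMap.evalCLM ℝ x

/-- The norm closure of the linear span of the Dirac functionals. -/
noncomputable def diracClosure (K : Type u) [TopologicalSpace K] [CompactSpace K] :
    Submodule ℝ (StrongDual ℝ C(K, ℝ)) :=
  (Submodule.span ℝ (Set.range (diracFunctional (K := K)))).topologicalClosure

/-! ### Functionals on a scattered compact space -/

section Dual

open TopologicalSpace

variable {K : Type u} [TopologicalSpace K] [CompactSpace K]

lemma clopenCut_apply (A : Clopens K) (φ : StrongDual ℝ C(K, ℝ)) (f : C(K, ℝ)) :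
    clopenCut A φ f = φ ((LocallyConstant.charFn ℝ A.isClopen : C(K, ℝ)) * f) := rfl

lemma diracFunctional_apply (x : K) (f : C(K, ℝ)) : diracFunctional x f = f x := rfl

omit [CompactSpace K] in
lemma charFn_apply_of_mem {A : Clopens K} {x : K} (h : x ∈ A) :
    (LocallyConstant.charFn ℝ A.isClopen : C(K, ℝ)) x = 1 := by
  have : x ∈ (A : Set K) := h
  simp [LocallyConstant.coe_charFn, this]

omit [CompactSpace K] in
lemma charFn_apply_of_notMem {A : Clopens K} {x : K} (h : x ∉ A) :
    (LocallyConstant.charFn ℝ A.isClopen : C(K, ℝ)) x = 0 := by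
  have : x ∉ (A : Set K) := h
  simp [LocallyConstant.coe_charFn, this]

lemma clopenCut_congr (φ : StrongDual ℝ C(K, ℝ)) {A : Clopens K} {f g : C(K, ℝ)}
    (h : ∀ x ∈ A, f x = g x) : clopenCut A φ f = clopenCut A φ g := by
  rw [clopenCut_apply, clopenCut_apply]
  congr 1
  ext x
  by_cases hx : x ∈ A
  · simp [h x hx]
  · simp only [ContinuousMap.mul_apply, charFn_apply_of_notMem hx, zero_mul]

lemma clopenCut_top (φ : StrongDual ℝ C(K, ℝ)) : clopenCut ⊤ φ = φ := by
  ext f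
  rw [clopenCut_apply]
  congr 1
  ext x
  rw [ContinuousMap.mul_apply, charFn_apply_of_mem (by trivial), one_mul]

lemma clopenCut_bot (φ : StrongDual ℝ C(K, ℝ)) : clopenCut ⊥ φ = 0 := by
  ext f
  rw [clopenCut_congr φ (g := 0) (fun x (hx : x ∈ (∅ : Set K)) => hx.elim)]
  exact map_zero _

lemma clopenCut_clopenCut_of_le (φ : StrongDual ℝ C(K, ℝ)) {A B : Clopens K} (h : A ≤ B) :
    clopenCut A (clopenCut B φ) = clopenCut A φ := by
  ext f
  rw [clopenCut_apply, clopenCut_apply, clopenCut_apply]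
  congr 1
  ext x
  by_cases hx : x ∈ A
  · simp [charFn_apply_of_mem (h hx)]
  · simp only [ContinuousMap.mul_apply, charFn_apply_of_notMem hx, zero_mul, mul_zero]

lemma clopenCut_sup (φ : StrongDual ℝ C(K, ℝ)) {A B : Clopens K} (h : Disjoint A B) :
    clopenCut (A ⊔ B) φ = clopenCut A φ + clopenCut B φ := by
  ext f
  rw [add_apply, clopenCut_apply, clopenCut_apply, clopenCut_apply, ← map_add]
  congr 1
  ext x
  have hd : x ∈ A → x ∈ B → False := fun hA hB =>
    (h.le_bot (show x ∈ A ⊓ B from ⟨hA, hB⟩)).elim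
  simp only [ContinuousMap.mul_apply, ContinuousMap.add_apply]
  by_cases hA : x ∈ A
  · rw [charFn_apply_of_mem hA, charFn_apply_of_notMem fun hB => hd hA hB,
      charFn_apply_of_mem (show x ∈ A ⊔ B from Or.inl hA)]
    simp
  · by_cases hB : x ∈ B
    · rw [charFn_apply_of_notMem hA, charFn_apply_of_mem hB,
        charFn_apply_of_mem (show x ∈ A ⊔ B from Or.inr hB)]
      simp
    · rw [charFn_apply_of_notMem hA, charFn_apply_of_notMem hB,
        charFn_apply_of_notMem (fun h : x ∈ A ⊔ B => h.elim hA hB)]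
      simp

lemma norm_le_of_forall_apply_le {E : Type*} [NormedAddCommGroup E] [NormedSpace ℝ E]
    (ψ : StrongDual ℝ E) {c : ℝ} (h : ∀ f, ‖f‖ ≤ 1 → ψ f ≤ c) : ‖ψ‖ ≤ c := by
  refine ψ.opNorm_le_of_unit_norm (by simpa using h 0 (by simp)) fun f hf => ?_
  rw [Real.norm_eq_abs, abs_le']
  exact ⟨h f hf.le, by simpa using h (-f) (by simp [hf])⟩

/-- Test functions for the two cuts glue along `A` and its complement into one continuous function
of norm at most 1. This plays the role of additivity of total variation, without measures. -/
lemma norm_clopenCut_add_le (φ : StrongDual ℝ C(K, ℝ)) {A B : Clopens K} (h : Disjoint A B) :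
    ‖clopenCut A φ‖ + ‖clopenCut B φ‖ ≤ ‖clopenCut (A ⊔ B) φ‖ := by
  have key : ∀ f g : C(K, ℝ), ‖f‖ ≤ 1 → ‖g‖ ≤ 1 →
      clopenCut A φ f + clopenCut B φ g ≤ ‖clopenCut (A ⊔ B) φ‖ := by
    intro f g hf hg
    have hd : ∀ x, x ∈ A → x ∈ B → False := fun x hA hB =>
      (h.le_bot (show x ∈ A ⊓ B from ⟨hA, hB⟩)).elim
    set F : C(K, ℝ) := (LocallyConstant.charFn ℝ A.isClopen : C(K, ℝ)) * f +
      (LocallyConstant.charFn ℝ (Aᶜ : Clopens K).isClopen : C(K, ℝ)) * g with hF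
    have hFA : ∀ x ∈ A, F x = f x := fun x hx => by
      have : x ∉ (Aᶜ : Clopens K) := fun h => h hx
      simp only [hF, ContinuousMap.add_apply, ContinuousMap.mul_apply, charFn_apply_of_mem hx,
        charFn_apply_of_notMem this]
      ring
    have hFA' : ∀ x, x ∉ A → F x = g x := fun x hx => by
      have : x ∈ (Aᶜ : Clopens K) := hx
      simp only [hF, ContinuousMap.add_apply, ContinuousMap.mul_apply, charFn_apply_of_mem this,
        charFn_apply_of_notMem hx]
      ring
    have hFn : ‖F‖ ≤ 1 := by
      rw [ContinuousMap.norm_le _ zero_le_one]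
      intro x
      by_cases hx : x ∈ A
      · rw [hFA x hx]; exact (f.norm_coe_le_norm x).trans hf
      · rw [hFA' x hx]; exact (g.norm_coe_le_norm x).trans hg
    rw [← clopenCut_congr φ hFA,
      ← clopenCut_congr φ (f := F) (fun x hx => hFA' x fun hA => hd x hA hx),
      ← add_apply, ← clopenCut_sup φ h]
    calc _ ≤ ‖clopenCut (A ⊔ B) φ F‖ := Real.le_norm_self _
      _ ≤ ‖clopenCut (A ⊔ B) φ‖ * 1 := (clopenCut (A ⊔ B) φ).le_opNorm_of_le hFn
      _ = _ := mul_one _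
  have h1 : ∀ g : C(K, ℝ), ‖g‖ ≤ 1 →
      ‖clopenCut A φ‖ ≤ ‖clopenCut (A ⊔ B) φ‖ - clopenCut B φ g := fun g hg =>
    norm_le_of_forall_apply_le _ fun f hf => by linarith [key f g hf hg]
  have h2 : ‖clopenCut B φ‖ ≤ ‖clopenCut (A ⊔ B) φ‖ - ‖clopenCut A φ‖ :=
    norm_le_of_forall_apply_le _ fun g hg => by linarith [h1 g hg]
  linarith

lemma norm_clopenCut_mono (φ : StrongDual ℝ C(K, ℝ)) {A B : Clopens K} (h : A ≤ B) :
    ‖clopenCut A φ‖ ≤ ‖clopenCut B φ‖ := by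
  have := norm_clopenCut_add_le φ (A := A) (B := B \ A) disjoint_sdiff_self_right
  rw [sup_sdiff_cancel_right h] at this
  linarith [norm_nonneg (clopenCut (B \ A) φ)]

lemma norm_clopenCut_le (φ : StrongDual ℝ C(K, ℝ)) (A : Clopens K) :
    ‖clopenCut A φ‖ ≤ ‖φ‖ := by
  simpa [clopenCut_top] using norm_clopenCut_mono φ (le_top : A ≤ ⊤)

/-- Countable additivity of the variation near a point, in functional form: apart from the point
itself, small clopen neighbourhoods carry little of a functional. -/
lemma exists_clopen_norm_clopenCut_lt (φ : StrongDual ℝ C(K, ℝ)) (x : K) {ε : ℝ} (hε : 0 < ε) :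
    ∃ A : Clopens K, x ∈ A ∧ ∀ C ≤ A, x ∉ C → ‖clopenCut C φ‖ < ε := by
  set S : Set ℝ := (fun C : Clopens K => ‖clopenCut C φ‖) '' {C | x ∉ C} with hS
  have hb : BddAbove S := ⟨‖φ‖, by rintro _ ⟨C, -, rfl⟩; exact norm_clopenCut_le φ C⟩
  have hne : S.Nonempty := ⟨_, ⊥, fun h => h, rfl⟩
  -- `C₀` nearly attains the supremum over clopen sets missing `x`; a disjoint `C` missing `x` with
  -- norm at least `ε` would push `C₀ ⊔ C` above it.
  obtain ⟨_, ⟨C₀, hC₀, rfl⟩, hlt⟩ := exists_lt_of_lt_csSup hne (show sSup S - ε < sSup S by linarith)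
  refine ⟨C₀ᶜ, hC₀, fun C hC hx => ?_⟩
  have hd : Disjoint C₀ C := disjoint_compl_right.mono_right hC
  have h1 := norm_clopenCut_add_le φ hd
  have h2 : ‖clopenCut (C₀ ⊔ C) φ‖ ≤ sSup S :=
    le_csSup hb ⟨C₀ ⊔ C, fun h => h.elim hC₀ hx, rfl⟩
  simp only at hlt
  linarith

lemma diracFunctional_mem_diracClosure (x : K) : diracFunctional x ∈ diracClosure K :=
  Submodule.le_topologicalClosure _ (Submodule.subset_span ⟨x, rfl⟩)

/-- Cutting sends a Dirac functional to itself or to 0, and it is norm continuous. -/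
lemma clopenCut_mem_diracClosure {φ : StrongDual ℝ C(K, ℝ)} (h : φ ∈ diracClosure K)
    (A : Clopens K) : clopenCut A φ ∈ diracClosure K := by
  have : Submodule.span ℝ (Set.range (diracFunctional (K := K))) ≤
      (Submodule.span ℝ (Set.range (diracFunctional (K := K)))).comap
        (clopenCut A : StrongDual ℝ C(K, ℝ) →ₗ[ℝ] StrongDual ℝ C(K, ℝ)) := by
    rw [Submodule.span_le]
    rintro _ ⟨x, rfl⟩
    rw [SetLike.mem_coe, Submodule.mem_comap]
    change clopenCut A (diracFunctional x) ∈
      Submodule.span ℝ (Set.range (diracFunctional (K := K)))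
    by_cases hx : x ∈ A
    · have : clopenCut A (diracFunctional x) = diracFunctional x := by
        ext f
        rw [clopenCut_apply]
        simp only [diracFunctional_apply, ContinuousMap.mul_apply, charFn_apply_of_mem hx,
          one_mul]
      rw [this]
      exact Submodule.subset_span ⟨x, rfl⟩
    · have : clopenCut A (diracFunctional x) = 0 := by
        ext f
        rw [clopenCut_apply]
        simp only [diracFunctional_apply, ContinuousMap.mul_apply,
          charFn_apply_of_notMem hx, zero_mul, zero_apply]
      rw [this]
      exact Submodule.zero_mem _
  have hm : Set.MapsTo (clopenCut A)
      (Submodule.span ℝ (Set.range (diracFunctional (K := K))) : Set (StrongDual ℝ C(K, ℝ)))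
      (Submodule.span ℝ (Set.range (diracFunctional (K := K))) : Set (StrongDual ℝ C(K, ℝ))) := this
  exact hm.closure (clopenCut A).continuous h

lemma clopenCut_mem_diracClosure_of_le {φ : StrongDual ℝ C(K, ℝ)} {A B : Clopens K}
    (h : clopenCut B φ ∈ diracClosure K) (hAB : A ≤ B) : clopenCut A φ ∈ diracClosure K := by
  rw [← clopenCut_clopenCut_of_le φ hAB]
  exact clopenCut_mem_diracClosure h A

lemma clopenCut_sup_mem_diracClosure {φ : StrongDual ℝ C(K, ℝ)} {A B : Clopens K}
    (hA : clopenCut A φ ∈ diracClosure K) (hB : clopenCut B φ ∈ diracClosure K) :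
    clopenCut (A ⊔ B) φ ∈ diracClosure K := by
  rw [← sup_sdiff_self_right A B, clopenCut_sup φ disjoint_sdiff_self_right]
  exact add_mem hA (clopenCut_mem_diracClosure_of_le hB sdiff_le)

lemma clopenCut_mem_diracClosure_of_cover {φ : StrongDual ℝ C(K, ℝ)} (A : Clopens K)
    (h : ∀ x ∈ A, ∃ B : Clopens K, x ∈ B ∧ clopenCut B φ ∈ diracClosure K) :
    clopenCut A φ ∈ diracClosure K := by
  obtain ⟨B, hAB, hB⟩ : ∃ B : Clopens K, (A : Set K) ⊆ B ∧ clopenCut B φ ∈ diracClosure K := by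
    refine A.isClopen.isClosed.isCompact.induction_on
      (p := fun s => ∃ B : Clopens K, s ⊆ B ∧ clopenCut B φ ∈ diracClosure K) ?_ ?_ ?_ ?_
    · exact ⟨⊥, Set.empty_subset _, by rw [clopenCut_bot]; exact zero_mem _⟩
    · rintro s t hst ⟨B, hB, h⟩
      exact ⟨B, hst.trans hB, h⟩
    · rintro s t ⟨B, hB, h⟩ ⟨C, hC, h'⟩
      exact ⟨B ⊔ C, Set.union_subset_union hB hC, clopenCut_sup_mem_diracClosure h h'⟩
    · intro x hx
      obtain ⟨B, hxB, hB⟩ := h x hx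
      exact ⟨B, mem_nhdsWithin_of_mem_nhds (B.isClopen.isOpen.mem_nhds hxB), B, subset_rfl, hB⟩
  exact clopenCut_mem_diracClosure_of_le hB hAB

lemma exists_clopens_of_mem_nhds [T2Space K] [TotallyDisconnectedSpace K] {x : K} {U : Set K}
    (hU : U ∈ nhds x) : ∃ A : Clopens K, x ∈ A ∧ (A : Set K) ⊆ U := by
  obtain ⟨V, hV, hx, hVU⟩ := isTopologicalBasis_isClopen.mem_nhds_iff.1 hU
  exact ⟨⟨V, hV⟩, hx, hVU⟩

/-- If away from `x` a clopen set only carries little of `φ`, then there `φ` is close to a multiple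
of the Dirac functional at `x`. -/
lemma norm_clopenCut_sub_smul_evalCLM_le [T2Space K] [TotallyDisconnectedSpace K]
    (φ : StrongDual ℝ C(K, ℝ)) {x : K} {ε : ℝ} {A : Clopens K}
    (hA : ∀ C ≤ A, x ∉ C → ‖clopenCut C φ‖ < ε) :
    ‖clopenCut A φ - clopenCut A φ 1 • diracFunctional x‖ ≤ 2 * ε := by
  refine norm_le_of_forall_apply_le _ fun f hf => le_of_forall_pos_le_add fun η hη => ?_
  obtain ⟨δ, hδ, hδη⟩ : ∃ δ > 0, ‖φ‖ * δ ≤ η :=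
    ⟨η / (‖φ‖ + 1), by positivity, by
      rw [mul_div_assoc', div_le_iff₀ (by positivity)]
      nlinarith [norm_nonneg φ]⟩
  -- Removing the constant `f x` accounts for the Dirac term. The remainder `g` is small on a clopen
  -- `N` around `x`, while off `N` the cut has norm below `ε` and `‖g‖ ≤ 2`.
  set g : C(K, ℝ) := f - ContinuousMap.const K (f x) with hg
  have hg2 : ‖g‖ ≤ 2 := by
    rw [ContinuousMap.norm_le _ zero_le_two]
    intro y
    calc ‖f y - f x‖ ≤ ‖f y‖ + ‖f x‖ := norm_sub_le _ _
      _ ≤ 1 + 1 := add_le_add ((f.norm_coe_le_norm y).trans hf) ((f.norm_coe_le_norm x).trans hf)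
      _ = 2 := by norm_num
  have hgx : g x = 0 := by simp [hg]
  obtain ⟨N, hxN, hN⟩ := exists_clopens_of_mem_nhds (x := x) (U := {y | ‖g y‖ < δ})
    ((isOpen_lt (g.continuous.norm) continuous_const).mem_nhds (by simpa [hgx] using hδ))
  have hval : (clopenCut A φ - clopenCut A φ 1 • diracFunctional x) f
      = clopenCut A φ g := by
    have : ContinuousMap.const K (f x) = f x • (1 : C(K, ℝ)) := by ext; simp
    rw [hg, map_sub, this, map_smul]
    change clopenCut A φ f - clopenCut A φ 1 * f x = _
    rw [smul_eq_mul, mul_comm]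
  have hsplit : clopenCut A φ g = clopenCut (A ⊓ N) φ g + clopenCut (A \ N) φ g := by
    rw [← add_apply, ← clopenCut_sup φ disjoint_inf_sdiff, sup_inf_sdiff]
  have h1 : clopenCut (A ⊓ N) φ g ≤ η := by
    rw [clopenCut_apply]
    refine (Real.le_norm_self _).trans ((φ.le_opNorm_of_le ?_).trans hδη)
    rw [ContinuousMap.norm_le _ hδ.le]
    intro y
    by_cases hy : y ∈ A ⊓ N
    · rw [ContinuousMap.mul_apply, charFn_apply_of_mem hy, one_mul]
      exact (show ‖g y‖ < δ from hN hy.2).le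
    · rw [ContinuousMap.mul_apply, charFn_apply_of_notMem hy, zero_mul, norm_zero]
      exact hδ.le
  have h2 : clopenCut (A \ N) φ g ≤ ε * 2 := by
    have hlt := hA (A \ N) sdiff_le (fun h => h.2 hxN)
    refine (Real.le_norm_self _).trans (((clopenCut (A \ N) φ).le_opNorm_of_le hg2).trans ?_)
    linarith
  rw [hval, hsplit]
  linarith

/-- An isolated point `x` of a preconnected set `t` splits off: `U` and `{x}ᶜ` cover `t` and do not
meet inside it. -/
lemma IsScatteredSpace.totallyDisconnectedSpace {X : Type u} [TopologicalSpace X] [T1Space X]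
    (h : IsScatteredSpace X) : TotallyDisconnectedSpace X := by
  refine ⟨fun t _ ht => ?_⟩
  rcases t.eq_empty_or_nonempty with rfl | hne
  · exact Set.subsingleton_empty
  obtain ⟨x, hx, U, hU, hUt⟩ := h t hne
  by_contra hns
  obtain ⟨y, hy, hyx⟩ := (Set.not_subsingleton_iff.1 hns).exists_ne x
  have hxU : x ∈ U := (hUt.ge rfl).1
  obtain ⟨z, hzt, hzU, hzx⟩ := ht U {x}ᶜ hU isOpen_compl_singleton
    (fun z _ => by by_cases hz : z = x
                   · exact Or.inl (hz ▸ hxU)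
                   · exact Or.inr hz) ⟨x, hx, hxU⟩ ⟨y, hy, hyx⟩
  exact hzx (hUt.le ⟨hzU, hzt⟩)

/-- Rudin's theorem: on a scattered compact space every functional is a norm limit of
finite linear combinations of Dirac functionals. -/
theorem IsScatteredSpace.diracClosure_eq_top [T2Space K] (hK : IsScatteredSpace K) :
    diracClosure K = ⊤ := by
  have := hK.totallyDisconnectedSpace
  rw [eq_top_iff]
  intro φ _
  set W : Set K := {x | ∃ B : Clopens K, x ∈ B ∧ clopenCut B φ ∈ diracClosure K} with hW
  suffices hWK : W = Set.univ by
    rw [← clopenCut_top φ]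
    exact clopenCut_mem_diracClosure_of_cover ⊤ fun x _ => hWK.ge (Set.mem_univ x)
  by_contra hne
  -- At an isolated point `x` of the bad set `Wᶜ`, a small clopen `B` has no other bad point. So `φ`
  -- is good on `B \ A`, and on `A` it is nearly a multiple of the Dirac functional at `x`; this
  -- contradicts `x ∉ W`.
  obtain ⟨x, hx, U, hU, hUW⟩ := hK Wᶜ (Set.nonempty_compl.2 hne)
  obtain ⟨B, hxB, hBU⟩ := exists_clopens_of_mem_nhds (hU.mem_nhds (hUW.ge rfl).1)
  refine hx ⟨B, hxB, ?_⟩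
  have hclosed : IsClosed (diracClosure K : Set (StrongDual ℝ C(K, ℝ))) :=
    Submodule.isClosed_topologicalClosure _
  change clopenCut B φ ∈ (diracClosure K : Set (StrongDual ℝ C(K, ℝ)))
  rw [← hclosed.closure_eq]
  refine (Metric.mem_closure_iff (α := StrongDual ℝ C(K, ℝ))).2 fun ε hε => ?_
  obtain ⟨A₀, hxA₀, hA₀⟩ := exists_clopen_norm_clopenCut_lt φ x (ε := ε / 3) (by positivity)
  set A : Clopens K := A₀ ⊓ B
  have hdiff : clopenCut (B \ A) φ ∈ diracClosure K := by
    refine clopenCut_mem_diracClosure_of_cover _ fun y hy => ?_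
    have hyW : y ∈ W := by
      by_contra hyW
      have hyx : y = x := hUW.le ⟨hBU hy.1, hyW⟩
      exact hy.2 (hyx ▸ ⟨hxA₀, hxB⟩)
    exact hyW
  refine ⟨clopenCut (B \ A) φ + clopenCut A φ 1 • diracFunctional x,
    add_mem hdiff (Submodule.smul_mem _ _ (diracFunctional_mem_diracClosure x)), ?_⟩
  have hB : clopenCut B φ = clopenCut A φ + clopenCut (B \ A) φ := by
    rw [← clopenCut_sup φ disjoint_sdiff_self_right, sup_sdiff_cancel_right inf_le_right]
  have := norm_clopenCut_sub_smul_evalCLM_le φ (x := x) (ε := ε / 3) (A := A)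
    fun C hC hxC => hA₀ C (hC.trans inf_le_left) hxC
  refine (dist_eq_norm (E := StrongDual ℝ C(K, ℝ)) _ _).trans_lt ?_
  rw [hB]
  calc _ = ‖clopenCut A φ - clopenCut A φ 1 • diracFunctional x‖ := by congr 1; abel
    _ ≤ 2 * (ε / 3) := this
    _ < ε := by linarith

end Dual

/-! ### Transfer of hereditary density -/

/-- Every subset of `X` has a relatively dense subset of cardinality at most `κ`. -/
def HereditaryDensityLE (κ : Cardinal.{u}) (X : Type u) [TopologicalSpace X] : Prop :=
  ∀ Y : Set X, ∃ D ⊆ Y, #D ≤ κ ∧ Y ⊆ closure D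

section HereditaryDensity

variable {X Z : Type u} [TopologicalSpace X] [TopologicalSpace Z] {κ : Cardinal.{u}}

lemma exists_dense_card_le_subtype_iff (Y : Set X) :
    (∃ D : Set Y, Dense D ∧ #D ≤ κ) ↔ ∃ D ⊆ Y, #D ≤ κ ∧ Y ⊆ closure D := by
  constructor
  · rintro ⟨D, hD, hκ⟩
    refine ⟨Subtype.val '' D, by simp, mk_image_le.trans hκ, fun y hy => ?_⟩
    exact closure_subtype.1 (hD ⟨y, hy⟩)
  · rintro ⟨D, hDY, hκ, hD⟩
    refine ⟨Subtype.val ⁻¹' D, fun y => ?_, ?_⟩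
    · rw [closure_subtype, Subtype.image_preimage_coe, Set.inter_eq_right.2 hDY]
      exact hD y.2
    · exact (mk_preimage_of_injective _ _ Subtype.val_injective).trans hκ

lemma exists_dense_card_eq_topDensity (X : Type u) [TopologicalSpace X] :
    ∃ D : Set X, Dense D ∧ #D = topDensity X :=
  csInf_mem (s := {κ : Cardinal.{u} | ∃ D : Set X, Dense D ∧ #D = κ})
    ⟨_, Set.univ, dense_univ, rfl⟩

lemma topDensity_le_iff : topDensity X ≤ κ ↔ ∃ D : Set X, Dense D ∧ #D ≤ κ := by
  constructor
  · intro h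
    obtain ⟨D, hD, hc⟩ := exists_dense_card_eq_topDensity X
    exact ⟨D, hD, hc.trans_le h⟩
  · rintro ⟨D, hD, hc⟩
    exact (csInf_le' ⟨D, hD, rfl⟩ : topDensity X ≤ #D).trans hc

lemma hereditaryDensity_le_iff : hereditaryDensity X ≤ κ ↔ HereditaryDensityLE κ X := by
  unfold hereditaryDensity
  rw [ciSup_le_iff' bddAbove_of_small]
  exact forall_congr' fun Y => topDensity_le_iff.trans (exists_dense_card_le_subtype_iff Y)

lemma hereditarilySeparable_iff : HereditarilySeparable X ↔ HereditaryDensityLE ℵ₀ X := by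
  refine forall_congr' fun Y => ?_
  rw [← exists_dense_card_le_subtype_iff]
  constructor
  · rintro ⟨D, hc, hD⟩
    exact ⟨D, hD, hc.le_aleph0⟩
  · rintro ⟨D, hD, hc⟩
    exact ⟨D, le_aleph0_iff_set_countable.1 hc, hD⟩

lemma aleph0_le_topDensity [T1Space X] [Infinite X] : ℵ₀ ≤ topDensity X := by
  obtain ⟨D, hD, hc⟩ := exists_dense_card_eq_topDensity X
  rw [← hc]
  by_contra! hlt
  have hfin : D.Finite := lt_aleph0_iff_set_finite.1 hlt
  have : D = Set.univ := by rw [← hfin.isClosed.closure_eq, hD.closure_eq]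
  exact Set.infinite_univ (this ▸ hfin)

lemma aleph0_le_hereditaryDensity [T1Space X] [Infinite X] : ℵ₀ ≤ hereditaryDensity X := by
  obtain ⟨D, hD, hc⟩ := (exists_dense_card_le_subtype_iff (X := X) Set.univ).2
    (hereditaryDensity_le_iff.1 le_rfl Set.univ)
  refine aleph0_le_topDensity.trans ((topDensity_le_iff (X := X)).2
    ⟨Subtype.val '' D, ?_, mk_image_le.trans hc⟩)
  exact DenseRange.dense_image
    (Function.Surjective.denseRange fun x => ⟨⟨x, trivial⟩, rfl⟩) continuous_subtype_val hD

/-- Transfer of hereditary density along countably many relations which jointly detect the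
neighbourhoods in `X`. -/
theorem HereditaryDensityLE.of_relations (hκ : ℵ₀ ≤ κ) {ι : Type*} [Countable ι]
    {Z : ι → Type u} [∀ i, TopologicalSpace (Z i)] (hZ : ∀ i, HereditaryDensityLE κ (Z i))
    (r : ∀ i, X → Z i → Prop)
    (h : ∀ x, ∀ U ∈ nhds x, ∃ i z, r i x z ∧
      ∃ V ∈ nhds z, ∀ x' z', r i x' z' → z' ∈ V → x' ∈ U) :
    HereditaryDensityLE κ X := by
  intro Y
  -- For each `i`, take a small dense set of codes of points of `Y`, then one point of `Y` per
  -- chosen code.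
  choose D hDY hDκ hD using fun i => hZ i {z | ∃ y ∈ Y, r i y z}
  choose p hpY hpr using fun i (z : D i) => hDY i z.2
  refine ⟨⋃ i, Set.range (p i), Set.iUnion_subset fun i => ?_, ?_, fun y hy => ?_⟩
  · rintro _ ⟨z, rfl⟩
    exact hpY i z
  · rw [← lift_le.{_}]
    refine (mk_iUnion_le_lift _).trans ?_
    refine (mul_le_mul' (b := lift κ) (d := lift κ) ?_ (ciSup_le' fun i => ?_)).trans
      (mul_eq_self ?_).le
    · exact (lift_le_aleph0.2 (mk_le_aleph0)).trans (aleph0_le_lift.2 hκ)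
    · exact lift_le.2 (mk_range_le.trans (hDκ i))
    · exact aleph0_le_lift.2 hκ
  · rw [mem_closure_iff_nhds]
    intro U hU
    obtain ⟨i, z, hz, V, hV, hVU⟩ := h y U hU
    obtain ⟨z', hz'V, hz'D⟩ := mem_closure_iff_nhds.1 (hD i ⟨y, hy, hz⟩) V hV
    exact ⟨p i ⟨z', hz'D⟩, hVU _ _ (hpr i ⟨z', hz'D⟩) hz'V, Set.mem_iUnion.2 ⟨i, _, rfl⟩⟩

lemma HereditaryDensityLE.of_isInducing (hκ : ℵ₀ ≤ κ) (hZ : HereditaryDensityLE κ Z) {f : X → Z}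
    (hf : Topology.IsInducing f) : HereditaryDensityLE κ X := by
  refine .of_relations hκ (ι := Unit) (fun _ => hZ) (fun _ x z => f x = z) fun x U hU => ?_
  rw [hf.nhds_eq_comap, Filter.mem_comap] at hU
  obtain ⟨V, hV, hVU⟩ := hU
  exact ⟨(), f x, rfl, V, hV, fun x' _ hx' hz' => hVU (show f x' ∈ V from hx' ▸ hz')⟩

lemma HereditaryDensityLE.of_surjective (hκ : ℵ₀ ≤ κ) (hZ : HereditaryDensityLE κ Z) {f : Z → X}
    (hf : Continuous f) (hs : f.Surjective) : HereditaryDensityLE κ X := by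
  refine .of_relations hκ (ι := Unit) (fun _ => hZ) (fun _ x z => f z = x) fun x U hU => ?_
  obtain ⟨z, rfl⟩ := hs x
  exact ⟨(), z, rfl, f ⁻¹' U, hf.continuousAt hU, fun x' z' hx' hz' => hx' ▸ hz'⟩

lemma HereditaryDensityLE.prod_secondCountable (hκ : ℵ₀ ≤ κ) (hX : HereditaryDensityLE κ X)
    (S : Type) [TopologicalSpace S] [SecondCountableTopology S] :
    HereditaryDensityLE κ (X × S) := by
  have := (TopologicalSpace.countable_countableBasis S).to_subtype
  refine .of_relations hκ (ι := TopologicalSpace.countableBasis S) (fun _ => hX)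
    -- The second coordinate is controlled by the index, a basic open set, so only the first needs a
    -- code.
    (fun B x z => x.2 ∈ (B : Set S) ∧ x.1 = z) fun x U hU => ?_
  obtain ⟨V, hV, W, hW, hVW⟩ := mem_nhds_prod_iff.1 hU
  obtain ⟨B, hB, hxB, hBW⟩ :=
    (TopologicalSpace.isBasis_countableBasis S).mem_nhds_iff.1 hW
  exact ⟨⟨B, hB⟩, x.1, ⟨hxB, rfl⟩, V, hV, fun x' z' hx' hz' =>
    hVW ⟨hx'.2 ▸ hz', hBW hx'.1⟩⟩

lemma HereditaryDensityLE.pi_nat (hκ : ℵ₀ ≤ κ) (h : ∀ n : ℕ, HereditaryDensityLE κ (Fin n → X)) :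
    HereditaryDensityLE κ (ℕ → X) := by
  refine .of_relations hκ (ι := ℕ) h (fun n x z => (fun i : Fin n => x i) = z) fun x U hU => ?_
  rw [nhds_pi, Filter.mem_pi] at hU
  obtain ⟨I, hI, t, ht, htU⟩ := hU
  obtain ⟨n, hn⟩ := hI.bddAbove
  -- Coordinate `n` may itself be restricted, hence length `n + 1`.
  refine ⟨n + 1, _, rfl, Set.univ.pi fun i => t i, set_pi_mem_nhds Set.finite_univ fun i _ => ht i,
    ?_⟩
  rintro x' _ rfl hz
  exact htU fun i hi => hz ⟨i, Nat.lt_succ_of_le (hn hi)⟩ trivial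

lemma HereditaryDensityLE.pi_fin_of_pi_nat [Nonempty X] (hκ : ℵ₀ ≤ κ)
    (h : HereditaryDensityLE κ (ℕ → X)) (n : ℕ) : HereditaryDensityLE κ (Fin n → X) := by
  refine h.of_surjective hκ (f := fun x (i : Fin n) => x i) (by fun_prop) fun y => ?_
  exact ⟨fun i => if hi : i < n then y ⟨i, hi⟩ else Classical.arbitrary X, by ext; simp⟩

lemma HereditaryDensityLE.pi_finite (hκ : ℵ₀ ≤ κ) (h : ∀ n : ℕ, HereditaryDensityLE κ (Fin n → X))
    (ι : Type) [Finite ι] : HereditaryDensityLE κ (ι → X) := by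
  obtain ⟨n, ⟨e⟩⟩ := Finite.exists_equiv_fin ι
  refine (h n).of_surjective hκ (f := fun x i => x (e i)) (by fun_prop) fun y => ?_
  exact ⟨fun i => y (e.symm i), by simp⟩

lemma Topology.IsInducing.piMap_const {X Z : Type*} [TopologicalSpace X] [TopologicalSpace Z]
    {f : X → Z} (hf : Topology.IsInducing f) (ι : Type*) :
    Topology.IsInducing fun (x : ι → X) i => f (x i) :=
  Topology.IsInducing.piMap fun _ => hf

end HereditaryDensity

/-! ### Powers of the dual and of its ball -/

section Main

variable {K : Type u} [TopologicalSpace K] [CompactSpace K]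

lemma IsScatteredSpace.exists_finite_approx [T2Space K] (hK : IsScatteredSpace K)
    (φ : StrongDual ℝ C(K, ℝ)) {ε : ℝ} (hε : 0 < ε) :
    ∃ (N : ℕ) (p : Fin N → K) (a : Fin N → ℝ),
      ∀ f : C(K, ℝ), |φ f - ∑ i, a i * f (p i)| ≤ ε * ‖f‖ := by
  have hφ : φ ∈ diracClosure K := hK.diracClosure_eq_top ▸ Submodule.mem_top
  obtain ⟨ψ, hψ, hd⟩ := (Metric.mem_closure_iff (α := StrongDual ℝ C(K, ℝ))).1 hφ ε hε
  obtain ⟨N, a, g, rfl⟩ := Submodule.mem_span_set'.1 hψ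
  choose p hp using fun i => (g i).2
  refine ⟨N, p, a, fun f => ?_⟩
  replace hd := (dist_eq_norm (E := StrongDual ℝ C(K, ℝ)) _ _).symm.trans_lt hd
  have hs : (∑ i, a i • (g i : StrongDual ℝ C(K, ℝ))) f = ∑ i, a i * f (p i) := by
    rw [sum_apply]
    refine Finset.sum_congr rfl fun i _ => ?_
    rw [← hp i]
    rfl
  rw [← hs]
  exact ContinuousLinearMap.le_of_opNorm_le (φ - ∑ i, a i • (g i : StrongDual ℝ C(K, ℝ))) hd.le f

lemma exists_finset_of_mem_nhds_pi_weakDual {E : Type*} [NormedAddCommGroup E] [NormedSpace ℝ E]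
    {ι : Type*} [Finite ι] {x : ι → WeakDual ℝ E} {U : Set (ι → WeakDual ℝ E)} (hU : U ∈ nhds x) :
    ∃ (T : Finset E) (δ : ℝ), 0 < δ ∧ ∀ y, (∀ j, ∀ f ∈ T, |y j f - x j f| < δ) → y ∈ U := by
  classical
  cases nonempty_fintype ι
  rw [nhds_pi, Filter.mem_pi'] at hU
  obtain ⟨I, t, ht, htU⟩ := hU
  choose s r hr hs using fun j => (WeakDual.withSeminorms (𝕜 := ℝ) (E := E)).mem_nhds_iff (x j) _
    |>.1 (ht j)
  obtain ⟨δ, hδ, hδr⟩ : ∃ δ > 0, ∀ j, δ ≤ r j := by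
    rcases isEmpty_or_nonempty ι with h | h
    · exact ⟨1, one_pos, fun j => h.elim j⟩
    · obtain ⟨j₀, hj₀⟩ := Finite.exists_min r
      exact ⟨r j₀, hr j₀, hj₀⟩
  refine ⟨Finset.univ.biUnion s, δ, hδ, fun y hy => htU fun j _ => hs j ?_⟩
  rw [Seminorm.mem_ball]
  refine Seminorm.finset_sup_apply_lt (hr j) fun f hf => ?_
  exact (hy j f (Finset.mem_biUnion.2 ⟨j, Finset.mem_univ j, hf⟩)).trans_le (hδr j)

theorem HereditaryDensityLE.pi_weakDual [T2Space K] (hK : IsScatteredSpace K) {κ : Cardinal.{u}}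
    (hκ : ℵ₀ ≤ κ) (h : ∀ n : ℕ, HereditaryDensityLE κ (Fin n → K)) (n : ℕ) :
    HereditaryDensityLE κ (Fin n → WeakDual ℝ C(K, ℝ)) := by
  -- The index records the precision and the number of Dirac terms for each functional; a code lists
  -- all points and coefficients.
  refine .of_relations hκ (ι := ℕ × (Fin n → ℕ))
    (Z := fun i => ((Σ j, Fin (i.2 j)) → K) × ((Σ j, Fin (i.2 j)) → ℝ))
    (fun i => (HereditaryDensityLE.pi_finite hκ h _).prod_secondCountable hκ _)
    (fun i x z => ∀ j (f : C(K, ℝ)),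
      |x j f - ∑ l, z.2 ⟨j, l⟩ * f (z.1 ⟨j, l⟩)| ≤ 1 / ((i.1 : ℝ) + 1) * ‖f‖) fun x U hU => ?_
  obtain ⟨T, δ, hδ, hTU⟩ := exists_finset_of_mem_nhds_pi_weakDual hU
  obtain ⟨M, hM⟩ : ∃ M : ℝ, ∀ f ∈ T, ‖f‖ ≤ M :=
    (T.finite_toSet.image norm).bddAbove.imp fun M hM f hf => hM ⟨f, hf, rfl⟩
  -- Three errors of at most `δ / 3` add up: `x'` to its code, code to code, code of `x` to `x`.
  obtain ⟨k, hk⟩ := exists_nat_gt (3 * M / δ)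
  have hsmall : ∀ f ∈ T, 1 / ((k : ℝ) + 1) * ‖f‖ < δ / 3 := fun f hf => by
    rw [div_lt_iff₀ hδ] at hk
    rw [one_div_mul_eq_div, div_lt_iff₀ (by positivity)]
    linarith [hM f hf]
  choose N p a hpa using fun j =>
    hK.exists_finite_approx (WeakDual.toStrongDual (x j)) (ε := 1 / ((k : ℝ) + 1)) (by positivity)
  refine ⟨(k, N), (fun l => p l.1 l.2, fun l => a l.1 l.2), hpa,
    {z | ∀ j, ∀ f ∈ T, |∑ l, z.2 ⟨j, l⟩ * f (z.1 ⟨j, l⟩) - ∑ l, a j l * f (p j l)| < δ / 3},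
    ?_, fun x' z' hx' hz' => hTU x' fun j f hf => ?_⟩
  · refine Filter.eventually_all.2 fun j => (Filter.eventually_all_finset T).2 fun f _ => ?_
    refine (Continuous.tendsto (f := fun z : ((Σ j, Fin (N j)) → K) × ((Σ j, Fin (N j)) → ℝ) =>
      |∑ l, z.2 ⟨j, l⟩ * f (z.1 ⟨j, l⟩) - ∑ l, a j l * f (p j l)|) (by fun_prop) _).eventually_lt
        tendsto_const_nhds ?_
    simpa using hδ
  · have h1 := abs_lt.1 ((hx' j f).trans_lt (hsmall f hf))
    have h2 := abs_lt.1 ((hpa j f).trans_lt (hsmall f hf))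
    have h3 := abs_lt.1 (hz' j f hf)
    simp only [WeakDual.toStrongDual_apply] at h1 h2 h3
    rw [abs_lt]
    constructor <;> linarith [h1.1, h1.2, h2.1, h2.2, h3.1, h3.2]

lemma diracFunctional_mem_weakStarDualBall (x : K) :
    StrongDual.toWeakDual (diracFunctional x) ∈ weakStarDualBall K := by
  change ‖diracFunctional x‖ ≤ 1
  exact norm_le_of_forall_apply_le _ fun f hf =>
    (Real.le_norm_self _).trans ((f.norm_coe_le_norm x).trans hf)

/-- A continuous injection of a compact space into a Hausdorff one is a closed embedding;
injectivity is Urysohn's lemma. -/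
lemma isInducing_diracFunctional [T2Space K] : Topology.IsInducing fun x : K =>
    (⟨StrongDual.toWeakDual (diracFunctional x), diracFunctional_mem_weakStarDualBall x⟩ :
      weakStarDualBall K) := by
  refine (Continuous.isClosedEmbedding ?_ ?_).isInducing
  · exact Continuous.subtype_mk (WeakDual.continuous_of_continuous_eval fun f => f.continuous) _
  · intro x y hxy
    by_contra hne
    obtain ⟨f, hf⟩ := exists_continuous_zero_one_of_isClosed (isClosed_singleton (x := x))
      (isClosed_singleton (x := y)) (by simpa using hne)
    have h : f x = f y := congr($(congrArg Subtype.val hxy) f)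
    simp [hf.1 rfl, hf.2.1 rfl] at h

end Main

theorem mainTheorem5 (K : Type u) [TopologicalSpace K] [CompactSpace K] [T2Space K]
    [Infinite K] (hK : IsScatteredSpace K) :
    hereditaryDensity (ℕ → K) = hereditaryDensity (ℕ → weakStarDualBall K) ∧
    ((∀ n : ℕ, HereditarilySeparable (Fin n → K)) ↔
      ∀ n : ℕ, HereditarilySeparable (Fin n → WeakDual ℝ C(K, ℝ))) ∧
    ((∀ n : ℕ, HereditarilySeparable (Fin n → K)) ↔
      ∀ n : ℕ, HereditarilySeparable (Fin n → weakStarDualBall K)) := by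
  have hball : Topology.IsInducing (Subtype.val : weakStarDualBall K → WeakDual ℝ C(K, ℝ)) :=
    Topology.IsInducing.subtypeVal
  have hdirac := isInducing_diracFunctional (K := K)
  simp only [hereditarilySeparable_iff]
  refine ⟨le_antisymm ?_ ?_, ⟨?_, fun h n => ?_⟩, ⟨fun h n => ?_, fun h n => ?_⟩⟩
  · have : Infinite (weakStarDualBall K) := Infinite.of_injective _ hdirac.injective
    exact hereditaryDensity_le_iff.2 ((hereditaryDensity_le_iff.1 le_rfl).of_isInducing
      aleph0_le_hereditaryDensity (hdirac.piMap_const ℕ))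
  · have hκ : ℵ₀ ≤ hereditaryDensity (ℕ → K) := aleph0_le_hereditaryDensity
    have h := HereditaryDensityLE.pi_weakDual hK hκ
      (HereditaryDensityLE.pi_fin_of_pi_nat hκ (hereditaryDensity_le_iff.1 le_rfl))
    exact hereditaryDensity_le_iff.2
      ((HereditaryDensityLE.pi_nat hκ h).of_isInducing hκ (hball.piMap_const ℕ))
  · exact HereditaryDensityLE.pi_weakDual hK le_rfl
  · exact (h n).of_isInducing le_rfl ((hball.comp hdirac).piMap_const (Fin n))
  · exact (HereditaryDensityLE.pi_weakDual hK le_rfl h n).of_isInducing le_rfl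
      (hball.piMap_const (Fin n))
  · exact (h n).of_isInducing le_rfl (hdirac.piMap_const (Fin n))
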